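/- Let $p$ be a prime with $p\equiv 1$ or $9 \pmod{20}$. Then there are integers $M,N$ with $p=M^2+N^2$, $N$ even and $M\equiv 1\pmod 4$, and there are integers $A,B$ with $p=A^2+5B^2$. For every such pair $(M,N)$, exactly one of $M$ and $N$ is divisible by $5$; and for every such $(M,N)$ and every such $(A,B)$: (a) if $p\equiv 1\pmod{20}$, then $A$ is even if and only if $5\mid M$; (b) if $p\equiv 9\pmod{20}$, then $A$ is even if and only if $5\mid N$. -/

import Mathlib

/-! Subtracting p = x² + y² from p = A² + 5B² gives (A+x)(A-x) = y² - 5B². Take x to be whichever of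
M, N has parity opposite to A, so both factors are odd. By quadratic reciprocity, an odd divisor of
a norm form y² - 5z² is ±1 mod 5 when it is prime to 5 and no prime divides it, its cofactor, y and
z at once. If 5 ∣ x, then A ≡ A+x gives p ≡ A² ≡ 1 mod 5. If 5 ∣ y, one factor vanishes mod 5, the
other is ≡ 2A, so 4A² ≡ 1 and p ≡ 4. Existence of A, B comes from Thue's lemma applied to a square
root of -5 mod p. -/

/-- An odd prime at which `5` is a nonzero square is congruent to `±1` modulo `5`. -/
theorem sq_mod_five_of_prime_dvd {q : ℕ} (hq : q.Prime) (hq2 : q ≠ 2) (hq5 : q ≠ 5) {y z : ℤ}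
    (h : (q : ℤ) ∣ y ^ 2 - 5 * z ^ 2) (hz : ¬ (q : ℤ) ∣ z) : (5 : ℤ) ∣ (q : ℤ) ^ 2 - 1 := by
  have key : ∀ a : ZMod 5, IsSquare a → a ≠ 0 → a ^ 2 - 1 = 0 := by decide
  have : Fact q.Prime := ⟨hq⟩
  have : Fact (Nat.Prime 5) := ⟨by norm_num⟩
  have hz' : (z : ZMod q) ≠ 0 := by rwa [Ne, ZMod.intCast_zmod_eq_zero_iff_dvd]
  have h' : (y : ZMod q) ^ 2 - 5 * (z : ZMod q) ^ 2 = 0 := by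
    have := (ZMod.intCast_zmod_eq_zero_iff_dvd _ q).2 h
    push_cast at this
    exact this
  have hs : IsSquare ((5 : ℕ) : ZMod q) := by
    refine ⟨y / z, ?_⟩
    field_simp
    push_cast
    linear_combination -h'
  have hs' : IsSquare ((q : ℕ) : ZMod 5) :=
    (ZMod.exists_sq_eq_prime_iff_of_mod_four_eq_one (p := 5) (q := q) (by norm_num) hq2).2 hs
  have hq0 : ((q : ℕ) : ZMod 5) ≠ 0 := by
    rw [Ne, ZMod.natCast_eq_zero_iff, Nat.prime_dvd_prime_iff_eq (by norm_num) hq]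
    exact fun h => hq5 h.symm
  have := key _ hs' hq0
  refine (ZMod.intCast_zmod_eq_zero_iff_dvd _ 5).1 ?_
  push_cast
  exact this

/-- An odd divisor `n` of a value `y ^ 2 - 5 * z ^ 2` which is prime to `5`, and such that `n`, its
cofactor, `y` and `z` have no common prime factor, is congruent to `±1` modulo `5`. -/
theorem sq_mod_five_of_mul_eq (n : ℕ) : ∀ m y z : ℤ, Odd n → ¬ 5 ∣ n →
    (n : ℤ) * m = y ^ 2 - 5 * z ^ 2 →
    (∀ q : ℕ, q.Prime → (q : ℤ) ∣ n → (q : ℤ) ∣ m → (q : ℤ) ∣ y → (q : ℤ) ∣ z → False) →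
    (5 : ℤ) ∣ (n : ℤ) ^ 2 - 1 := by
  induction n using Nat.strong_induction_on with
  | _ n ih =>
  intro m y z hodd h5 hmul hcop
  rcases eq_or_ne n 1 with rfl | hn1
  · norm_num
  have hnpos : 0 < n := hodd.pos
  obtain ⟨q, hq, n', rfl⟩ := Nat.exists_prime_and_dvd hn1
  have hqodd : Odd q := (Nat.odd_mul.1 hodd).1
  have hn'odd : Odd n' := (Nat.odd_mul.1 hodd).2
  have hq2 : q ≠ 2 := by rintro rfl; exact absurd hqodd (by decide)
  have hq5 : q ≠ 5 := by rintro rfl; exact h5 (dvd_mul_right _ _)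
  have hqZ : Prime (q : ℤ) := Nat.prime_iff_prime_int.1 hq
  have hq0 : (q : ℤ) ≠ 0 := hqZ.ne_zero
  have hdvd : (q : ℤ) ∣ y ^ 2 - 5 * z ^ 2 := ⟨n' * m, by rw [← hmul]; push_cast; ring⟩
  have hn'pos : 0 < n' := hn'odd.pos
  -- If q ∣ z then q² ∣ n * m with q ∤ m, so q² divides n and can be cancelled; q⁴ ≡ 1 mod 5
  -- whatever q is. Otherwise reciprocity applies to q, which moves into the cofactor and creates no
  -- common prime because q ∤ z.
  by_cases hz : (q : ℤ) ∣ z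
  · have hy : (q : ℤ) ∣ y := by
      refine hqZ.dvd_of_dvd_pow (n := 2) ?_
      have := dvd_add hdvd (Dvd.dvd.mul_left (dvd_pow hz two_ne_zero) 5)
      simpa using this
    have hm : ¬ (q : ℤ) ∣ m := fun hm =>
      hcop q hq (by push_cast; exact dvd_mul_right _ _) hm hy hz
    obtain ⟨y', rfl⟩ := hy
    obtain ⟨z', rfl⟩ := hz
    have h1 : (n' : ℤ) * m = q * (y' ^ 2 - 5 * z' ^ 2) := by
      apply mul_left_cancel₀ hq0
      push_cast at hmul
      linear_combination hmul
    have h2 : (q : ℤ) ∣ n' := (hqZ.dvd_or_dvd ⟨_, h1⟩).resolve_right hm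
    obtain ⟨k, rfl⟩ := Int.natCast_dvd_natCast.1 h2
    have h3 : (k : ℤ) * m = y' ^ 2 - 5 * z' ^ 2 := by
      apply mul_left_cancel₀ hq0
      push_cast at h1
      linear_combination h1
    have hk := ih k (by nlinarith [hq.two_le, Nat.pos_of_mul_pos_left hn'pos]) m y' z'
      (Nat.odd_mul.1 hn'odd).2 (fun h => h5 ((h.mul_left q).mul_left q)) h3
      (fun r hr hrk hrm hry hrz => hcop r hr
        (by push_cast; exact (hrk.mul_left _).mul_left _) hrm (hry.mul_left _) (hrz.mul_left _))
    have hq4 : (5 : ℤ) ∣ (q : ℤ) ^ 4 - 1 := by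
      have hq0 : ((q : ℕ) : ZMod 5) ≠ 0 := by
        rw [Ne, ZMod.natCast_eq_zero_iff, Nat.prime_dvd_prime_iff_eq (by norm_num) hq]
        exact fun h => hq5 h.symm
      have key : ∀ a : ZMod 5, a ≠ 0 → a ^ 4 - 1 = 0 := by decide
      have := key _ hq0
      refine (ZMod.intCast_zmod_eq_zero_iff_dvd _ 5).1 ?_
      push_cast
      exact this
    obtain ⟨a, ha⟩ := hk
    obtain ⟨b, hb⟩ := hq4
    refine ⟨q ^ 4 * a + b, ?_⟩
    push_cast
    linear_combination (q : ℤ) ^ 4 * ha + hb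
  · have hk := ih n' (by nlinarith [hq.two_le]) (q * m) y z hn'odd
      (fun h => h5 (h.mul_left q)) (by rw [← hmul]; push_cast; ring)
      (fun r hr hrn hrm hry hrz => by
        rcases (Nat.prime_iff_prime_int.1 hr).dvd_or_dvd hrm with h | h
        · rw [Int.natCast_dvd_natCast, Nat.prime_dvd_prime_iff_eq hr hq] at h
          exact hz (h ▸ hrz)
        · exact hcop r hr (by push_cast; exact hrn.mul_left _) h hry hrz)
    obtain ⟨a, ha⟩ := hk
    obtain ⟨b, hb⟩ := sq_mod_five_of_prime_dvd hq hq2 hq5 hdvd hz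
    refine ⟨q ^ 2 * a + b, ?_⟩
    push_cast
    linear_combination (q : ℤ) ^ 2 * ha + hb

/-- The same for a possibly negative odd integer `n`. -/
theorem int_sq_mod_five_of_mul_eq {n m y z : ℤ} (hodd : Odd n) (h5 : ¬ 5 ∣ n)
    (hmul : n * m = y ^ 2 - 5 * z ^ 2)
    (hcop : ∀ q : ℕ, q.Prime → (q : ℤ) ∣ n → (q : ℤ) ∣ m → (q : ℤ) ∣ y → (q : ℤ) ∣ z → False) :
    (5 : ℤ) ∣ n ^ 2 - 1 := by
  rw [← Int.natAbs_sq]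
  have h5' : ¬ 5 ∣ n.natAbs := fun h => h5 (Int.natCast_dvd.2 h)
  rcases Int.natAbs_eq n with h | h
  · refine sq_mod_five_of_mul_eq n.natAbs m y z (Int.natAbs_odd.2 hodd) h5' (by rw [← h, hmul]) ?_
    exact fun q hq hqn => hcop q hq (by rwa [h])
  · refine sq_mod_five_of_mul_eq n.natAbs (-m) y z (Int.natAbs_odd.2 hodd) h5'
      (by rw [← hmul]; nth_rewrite 2 [h]; ring) ?_
    exact fun q hq hqn hqm => hcop q hq (by rw [h]; exact hqn.neg_right) (by simpa using hqm)

/-- If `p = A ^ 2 + 5 * B ^ 2 = x ^ 2 + y ^ 2` with `A + x` odd, then the residue of `p` modulo `5`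
determines which of `x`, `y` is divisible by `5`. -/
theorem mod_five_of_two_representations {p : ℕ} (hp : p.Prime) (hp5 : p ≠ 5) {A B x y : ℤ}
    (hAB : (p : ℤ) = A ^ 2 + 5 * B ^ 2) (hxy : (p : ℤ) = x ^ 2 + y ^ 2) (hodd : Odd (A + x)) :
    ((5 : ℤ) ∣ x → (p : ℤ) % 5 = 1) ∧ ((5 : ℤ) ∣ y → (p : ℤ) % 5 = 4) := by
  have hA5 : ¬ (5 : ℤ) ∣ A := by
    rintro ⟨c, rfl⟩
    have : (5 : ℤ) ∣ p := ⟨5 * c ^ 2 + B ^ 2, by rw [hAB]; ring⟩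
    have : 5 ∣ p := by exact_mod_cast this
    exact hp5 ((Nat.prime_dvd_prime_iff_eq (by norm_num) hp).1 this).symm
  have hodd' : Odd (A - x) := by
    have := hodd.sub_even (even_two_mul x)
    rwa [show A + x - 2 * x = A - x by ring] at this
  have hmul : (A + x) * (A - x) = y ^ 2 - 5 * B ^ 2 := by linear_combination hxy - hAB
  have hcop : ∀ q : ℕ, q.Prime → (q : ℤ) ∣ A + x → (q : ℤ) ∣ A - x → (q : ℤ) ∣ y → (q : ℤ) ∣ B →
      False := by
    intro q hq h1 h2 _ h4
    have hqZ := Nat.prime_iff_prime_int.1 hq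
    have hA : (q : ℤ) ∣ 2 * A := by
      have := dvd_add h1 h2
      rwa [show A + x + (A - x) = 2 * A by ring] at this
    -- q = 2 contradicts the parity of A + x; q dividing A and B forces q² ∣ p.
    rcases hqZ.dvd_or_dvd hA with h | h
    · have h2' : q = 2 := by
        have : q ∣ 2 := by exact_mod_cast h
        exact (Nat.prime_dvd_prime_iff_eq hq Nat.prime_two).1 this
      subst h2'
      have := hodd
      rw [← Int.not_even_iff_odd, even_iff_two_dvd] at this
      exact this h1
    · obtain ⟨a, rfl⟩ := h
      obtain ⟨b, rfl⟩ := h4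
      have hsq : ((q * q : ℕ) : ℤ) ∣ p := ⟨a ^ 2 + 5 * b ^ 2, by rw [hAB]; push_cast; ring⟩
      have hsq' : q * q ∣ p := by exact_mod_cast hsq
      exact hq.one_lt.ne' (Nat.isUnit_iff.1 (hp.prime.squarefree q hsq'))
  have hcop' : ∀ q : ℕ, q.Prime → (q : ℤ) ∣ A - x → (q : ℤ) ∣ A + x → (q : ℤ) ∣ y →
      (q : ℤ) ∣ B → False := fun q hq h1 h2 => hcop q hq h2 h1
  constructor
  · rintro ⟨c, rfl⟩
    obtain ⟨d, hd⟩ := int_sq_mod_five_of_mul_eq hodd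
      (fun h => hA5 ((Int.dvd_add_left (dvd_mul_right 5 c)).1 h)) hmul hcop
    have : (p : ℤ) = 5 * (d - 2 * A * c - 5 * c ^ 2 + B ^ 2) + 1 := by
      linear_combination hAB + hd
    omega
  · rintro ⟨c, rfl⟩
    have h5 : Prime (5 : ℤ) := by norm_num
    have hdvd : (5 : ℤ) ∣ (A + x) * (A - x) := ⟨5 * c ^ 2 - B ^ 2, by rw [hmul]; ring⟩
    -- w is the factor divisible by 5, and 2 * A - w is the other one.
    have aux : ∀ w : ℤ, (5 : ℤ) ∣ w → (5 : ℤ) ∣ (2 * A - w) ^ 2 - 1 → (p : ℤ) % 5 = 4 := by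
      rintro _ ⟨w, rfl⟩ ⟨d, hd⟩
      have : 4 * (p : ℤ) = 5 * (d + 4 * A * w - 5 * w ^ 2 + 4 * B ^ 2) + 1 := by
        linear_combination 4 * hAB + hd
      omega
    have h2A : ¬ (5 : ℤ) ∣ 2 * A := by omega
    rcases h5.dvd_or_dvd hdvd with h | h
    · refine aux _ h ?_
      rw [show 2 * A - (A + x) = A - x by ring]
      exact int_sq_mod_five_of_mul_eq hodd' (by omega) (by rw [mul_comm]; exact hmul) hcop'
    · refine aux _ h ?_
      rw [show 2 * A - (A - x) = A + x by ring]
      exact int_sq_mod_five_of_mul_eq hodd (by omega) hmul hcop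

/-- Thue's lemma for a prime modulus. -/
theorem exists_small_solution_of_prime {p : ℕ} (hp : p.Prime) (r : ZMod p) :
    ∃ x y : ℤ, (x : ZMod p) = r * y ∧ x ^ 2 < p ∧ y ^ 2 < p ∧ (x ≠ 0 ∨ y ≠ 0) := by
  have : Fact p.Prime := ⟨hp⟩
  set s := Nat.sqrt p
  have hs : s * s < p := lt_of_le_of_ne (Nat.sqrt_le p) fun h =>
    hp.prime.irreducible.not_isSquare ⟨s, h.symm⟩
  have hcard : (Finset.univ : Finset (ZMod p)).card <
      (Finset.range (s + 1) ×ˢ Finset.range (s + 1)).card := by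
    rw [Finset.card_univ, ZMod.card, Finset.card_product, Finset.card_range]
    exact Nat.lt_succ_sqrt p
  obtain ⟨⟨a, b⟩, hab, ⟨c, d⟩, hcd, hne, heq⟩ :=
    Finset.exists_ne_map_eq_of_card_lt_of_maps_to hcard
      (f := fun u : ℕ × ℕ => (u.1 : ZMod p) - r * u.2) (fun _ _ => Finset.mem_univ _)
  simp only [Finset.mem_product, Finset.mem_range] at hab hcd
  have bound : ∀ u v : ℕ, u < s + 1 → v < s + 1 → ((u : ℤ) - v) ^ 2 < p := by
    intro u v hu hv
    have h1 : ((s : ℤ)) * s < p := by exact_mod_cast hs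
    have h2 : ((u : ℤ) - v) ^ 2 ≤ (s : ℤ) ^ 2 := sq_le_sq' (by omega) (by omega)
    nlinarith
  refine ⟨(a : ℤ) - c, (b : ℤ) - d, ?_, bound _ _ hab.1 hcd.1, bound _ _ hab.2 hcd.2, ?_⟩
  · push_cast
    linear_combination heq
  · by_contra! h
    apply hne
    ext <;> simp <;> omega

/-- A prime congruent to `1` or `9` modulo `20` is of the form `A ^ 2 + 5 * B ^ 2`. -/
theorem exists_eq_sq_add_five_mul_sq {p : ℕ} (hp : p.Prime) (hmod : p % 20 = 1 ∨ p % 20 = 9) :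
    ∃ A B : ℤ, (p : ℤ) = A ^ 2 + 5 * B ^ 2 := by
  have key1 : IsSquare ((1 : ℕ) : ZMod 5) := by decide
  have key4 : IsSquare ((4 : ℕ) : ZMod 5) := by decide
  have : Fact p.Prime := ⟨hp⟩
  have : Fact (Nat.Prime 5) := ⟨by norm_num⟩
  have hp4 : p % 4 = 1 := by omega
  have hs5 : IsSquare ((5 : ℕ) : ZMod p) := by
    refine (ZMod.exists_sq_eq_prime_iff_of_mod_four_eq_one (p := 5) (q := p) (by norm_num)
      (by omega)).1 ?_
    rw [← ZMod.natCast_mod]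
    rcases (by omega : p % 5 = 1 ∨ p % 5 = 4) with h | h <;> rw [h] <;> assumption
  have hs1 : IsSquare (-1 : ZMod p) := ZMod.exists_sq_eq_neg_one_iff.2 (by omega)
  obtain ⟨u, hu⟩ := hs5
  obtain ⟨i, hi⟩ := hs1
  -- (u * i)² = -5, so x² + 5y² is a multiple k * p with 0 < k < 6.
  obtain ⟨x, y, hxy, hx, hy, hne⟩ := exists_small_solution_of_prime hp (u * i)
  have hdvd : (p : ℤ) ∣ x ^ 2 + 5 * y ^ 2 := by
    rw [← ZMod.intCast_zmod_eq_zero_iff_dvd]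
    push_cast
    push_cast at hu
    rw [hxy]
    linear_combination (-(y : ZMod p) ^ 2 * i * i) * hu - 5 * (y : ZMod p) ^ 2 * hi
  obtain ⟨k, hk⟩ := hdvd
  have hpos : 0 < x ^ 2 + 5 * y ^ 2 := by
    rcases hne with h | h <;> positivity
  have hp0 : (0 : ℤ) < p := by exact_mod_cast hp.pos
  have hk0 : 0 < k := by
    rw [hk] at hpos
    exact pos_of_mul_pos_right hpos hp0.le
  have hk6 : k < 6 := by
    by_contra! h
    nlinarith
  have hx5 : x ^ 2 % 5 = 0 ∨ x ^ 2 % 5 = 1 ∨ x ^ 2 % 5 = 4 := by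
    rcases (by omega : x % 5 = 0 ∨ x % 5 = 1 ∨ x % 5 = 2 ∨ x % 5 = 3 ∨ x % 5 = 4) with
      h | h | h | h | h <;> simp [pow_two, Int.mul_emod, h]
  have hx4 : x ^ 2 % 4 = x % 2 := by
    rcases Int.even_or_odd' x with ⟨c, rfl | rfl⟩ <;> ring_nf <;> omega
  have hy4 : y ^ 2 % 4 = y % 2 := by
    rcases Int.even_or_odd' y with ⟨c, rfl | rfl⟩ <;> ring_nf <;> omega
  -- k = 2, 3 would make x² a nonresidue mod 5; k = 4 forces x, y even; k = 5 forces 5 ∣ x, and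
  -- dividing by 5 swaps the roles of x and y.
  interval_cases k
  · exact ⟨x, y, by linarith⟩
  · omega
  · omega
  · obtain ⟨a, rfl⟩ : (2 : ℤ) ∣ x := by omega
    obtain ⟨b, rfl⟩ : (2 : ℤ) ∣ y := by omega
    exact ⟨a, b, by linarith⟩
  · obtain ⟨a, rfl⟩ : (5 : ℤ) ∣ x :=
      Prime.dvd_of_dvd_pow (by norm_num : Prime (5 : ℤ)) (n := 2) (by omega)
    exact ⟨y, a, by linarith⟩

/-- A prime `p ≡ 1 (mod 4)` is a sum of an even square and the square of some `M ≡ 1 (mod 4)`. -/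
theorem exists_eq_sq_add_sq_normalized {p : ℕ} (hp : p.Prime) (hp4 : p % 4 = 1) :
    ∃ M N : ℤ, (p : ℤ) = M ^ 2 + N ^ 2 ∧ Even N ∧ M ≡ 1 [ZMOD 4] := by
  have : Fact p.Prime := ⟨hp⟩
  obtain ⟨a, b, hab⟩ := Nat.Prime.sq_add_sq (p := p) (by omega)
  have aux : ∀ a b : ℤ, (p : ℤ) = a ^ 2 + b ^ 2 → Odd a → Even b →
      ∃ M N : ℤ, (p : ℤ) = M ^ 2 + N ^ 2 ∧ Even N ∧ M ≡ 1 [ZMOD 4] := by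
    intro a b h ha hb
    rcases (by rw [Int.odd_iff] at ha; omega : a % 4 = 1 ∨ a % 4 = 3) with h4 | h4
    · exact ⟨a, b, h, hb, h4⟩
    · exact ⟨-a, b, by rw [h]; ring, hb, by unfold Int.ModEq; omega⟩
  have hab' : (p : ℤ) = (a : ℤ) ^ 2 + (b : ℤ) ^ 2 := by exact_mod_cast hab.symm
  have hodd : Odd ((a : ℤ) ^ 2 + (b : ℤ) ^ 2) := by rw [← hab', Int.odd_iff]; omega
  rcases Int.even_or_odd (a : ℤ) with ha | ha
  · refine aux b a (by rw [hab']; ring) ?_ ha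
    by_contra h
    rw [Int.not_odd_iff_even] at h
    exact absurd hodd (by simp [ha, h, Int.even_add, Int.even_pow])
  · refine aux a b hab' ha ?_
    by_contra h
    rw [Int.not_even_iff_odd] at h
    exact absurd ((ha.pow (n := 2)).add_odd (h.pow (n := 2))) (by simpa using hodd)

theorem xor_five_dvd_of_sq_add_sq {p M N : ℤ} (h : p = M ^ 2 + N ^ 2)
    (hp : p % 5 = 1 ∨ p % 5 = 4) : Xor ((5 : ℤ) ∣ M) ((5 : ℤ) ∣ N) := by
  have key : ∀ x : ℤ, (5 ∣ x ∧ x ^ 2 % 5 = 0) ∨ (¬ 5 ∣ x ∧ (x ^ 2 % 5 = 1 ∨ x ^ 2 % 5 = 4)) := by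
    intro x
    rcases (by omega : x % 5 = 0 ∨ x % 5 = 1 ∨ x % 5 = 2 ∨ x % 5 = 3 ∨ x % 5 = 4) with
      h | h | h | h | h <;> simp [pow_two, Int.mul_emod, h, Int.dvd_iff_emod_eq_zero]
  unfold Xor
  rcases key M with ⟨hM, hM'⟩ | ⟨hM, hM'⟩ <;> rcases key N with ⟨hN, hN'⟩ | ⟨hN, hN'⟩ <;>
    simp only [hM, hN, not_true_eq_false, not_false_eq_true, and_true, and_false, or_true,
      or_false, and_self, or_self] <;> omega

theorem mainTheorem9 (p : ℕ) (hp : p.Prime) (hmod : p ≡ 1 [MOD 20] ∨ p ≡ 9 [MOD 20]) :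
    (∃ M N : ℤ, (p : ℤ) = M ^ 2 + N ^ 2 ∧ Even N ∧ M ≡ 1 [ZMOD 4]) ∧
    (∃ A B : ℤ, (p : ℤ) = A ^ 2 + 5 * B ^ 2) ∧
    (∀ M N : ℤ, (p : ℤ) = M ^ 2 + N ^ 2 → Even N → M ≡ 1 [ZMOD 4] →
      Xor ((5 : ℤ) ∣ M) ((5 : ℤ) ∣ N) ∧
      ∀ A B : ℤ, (p : ℤ) = A ^ 2 + 5 * B ^ 2 →
        (p ≡ 1 [MOD 20] → (Even A ↔ (5 : ℤ) ∣ M)) ∧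
        (p ≡ 9 [MOD 20] → (Even A ↔ (5 : ℤ) ∣ N))) := by
  have hmod' : p % 20 = 1 ∨ p % 20 = 9 := hmod
  refine ⟨exists_eq_sq_add_sq_normalized hp (by omega), exists_eq_sq_add_five_mul_sq hp hmod', ?_⟩
  intro M N hMN hN hM
  have hxor := xor_five_dvd_of_sq_add_sq hMN (by omega)
  refine ⟨hxor, fun A B hAB => ?_⟩
  have hModd : Odd M := by
    rw [Int.odd_iff]
    have : M % 4 = 1 := hM
    omega
  -- The parity of A selects which of the odd M and the even N plays the role of x.
  have heven : Even A → ((5 : ℤ) ∣ M → (p : ℤ) % 5 = 1) ∧ ((5 : ℤ) ∣ N → (p : ℤ) % 5 = 4) :=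
    fun hA => mod_five_of_two_representations hp (by omega) hAB hMN (hA.add_odd hModd)
  have hoddA : ¬ Even A → ((5 : ℤ) ∣ N → (p : ℤ) % 5 = 1) ∧ ((5 : ℤ) ∣ M → (p : ℤ) % 5 = 4) :=
    fun hA => mod_five_of_two_representations hp (by omega) hAB (by rw [hMN]; ring)
      ((Int.not_even_iff_odd.1 hA).add_even hN)
  unfold Xor at hxor
  constructor
  · intro h
    have h1 : (p : ℤ) % 5 = 1 := by have : p % 20 = 1 := h; omega
    -- With p mod 5 known, each parity of A rules out one of 5 ∣ M, 5 ∣ N; the exclusive alternative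
    -- then gives the equivalence.
    rw [h1] at heven hoddA
    norm_num at heven hoddA
    rw [← Int.not_even_iff_odd] at hoddA
    tauto
  · intro h
    have h1 : (p : ℤ) % 5 = 4 := by have : p % 20 = 9 := h; omega
    rw [h1] at heven hoddA
    norm_num at heven hoddA
    rw [← Int.not_even_iff_odd] at hoddA
    tauto
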